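/- Let $n\ge 2$, $\alpha>\tfrac13$ and $\beta=\frac{\alpha-1}{2\alpha}\in(-1,\tfrac12)$. Let $\Gamma\subset\mathbb R^n$ be an open cone (invariant under positive scaling) that is invariant under permutations of the coordinates and contains $\{\lambda:\lambda_i>0 \text{ for all } i\}$, and let $\gamma:\Gamma\to(0,\infty)$ be smooth, symmetric, with $\partial\gamma/\partial\lambda_i>0$ on $\Gamma$ for every $i$, and $\gamma(c\lambda)=c^\alpha\gamma(\lambda)$ for $c>0$. Put $\tilde\gamma(x,y)=\gamma(x,y,\dots,y)$, and assume that $\gamma$ is $1$-nondegenerate, i.e. $(0,1,\dots,1)\in\Gamma$, and normalized, i.e. $\tilde\gamma(0,1)=1$. Let $x=g_+(y,z)\ge 0$ be the implicit function defined by $\tilde\gamma(x,y)=z$ for $y,z>0$ (wherever such an $x\ge0$ exists, in which case it is unique; in particular for $\tilde\gamma(1,1)^{-1/\alpha}\le y\le 1$ when $z=1$, with $g_+(1,1)=0$). Then $g_+(\cdot,1)$ is twice continuously differentiable from the left up to $y=1$, with one-sided derivatives $g_1=\partial_y g_+(1,1)<0$ and $g_2=\partial_y^2 g_+(1,1)$,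 and the following holds. Let $r_0\ge0$ and let $v:[r_0,\infty)\to\mathbb R$ be a solution of $$v'=(1+v^2)^{\beta+1}\,g_+\!\left(\frac{v}{r(1+v^2)^\beta},1\right)$$ with admissible initial data $v(r_0)=v_0$, i.e. $$\frac{v_0}{r_0(1+v_0^2)^\beta}\in\left[\tilde\gamma(1,1)^{-1/\alpha},\,1\right],$$ where for $r_0=0$ the equation is required on $(0,\infty)$, $v$ is continuous at $0$, and the quotient is read as $\lim_{r\to0^+}\frac{v(r)}{r(1+v(r)^2)^\beta}$. Then $$v(r)=r^\alpha-\frac{a}{r^\alpha}+\frac{b}{r^{3\alpha}}+o\!\left(r^{-4\alpha}\right)\qquad\text{as } r\to\infty,$$ where $$a=-\alpha\left(\frac{\alpha}{g_1}+\beta\right)$$ and $$b=\frac{2a\alpha^2-\alpha g_1\left[(1-2a)\beta\bigl(1+\beta(1-2a)\bigr)-2a^2\beta\right]+g_1\left(\frac a\alpha+\beta\right)(3\alpha-1)(1-2a)-\alpha g_2\left(\frac a\alpha+\beta\right)^2}{2\alpha g_1(1-2\beta)}.$$ -/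

import Mathlib

open Filter Asymptotics
open scoped Topology ContDiff

namespace Translator

/-- The vector `(x, y, …, y)` of `ℝⁿ`: first coordinate `x`, all others `y`. -/
def axial (n : ℕ) (x y : ℝ) : Fin n → ℝ := fun i => if (i : ℕ) = 0 then x else y

/-- The vector `(0, …, 0, 1, …, 1)` of `ℝⁿ` with `k` zeros. -/
def zerosOnes (n k : ℕ) : Fin n → ℝ := fun i => if (i : ℕ) < k then 0 else 1

/-- `Γ` is an open symmetric cone of `ℝⁿ` (invariant under positive scaling and under permutations
of the coordinates) that contains the positive cone `Γ₊`. -/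
structure IsAdmissibleCone {n : ℕ} (Γ : Set (Fin n → ℝ)) : Prop where
  isOpen : IsOpen Γ
  smul_mem : ∀ l ∈ Γ, ∀ c : ℝ, 0 < c → c • l ∈ Γ
  perm_mem : ∀ l ∈ Γ, ∀ σ : Equiv.Perm (Fin n), l ∘ σ ∈ Γ
  pos_mem : ∀ l : Fin n → ℝ, (∀ i, 0 < l i) → l ∈ Γ

/-- `γ : Γ → (0, ∞)` is a positive `α`-homogeneous curvature function. The values of `γ` outside
`Γ` are irrelevant. -/
structure IsCurvatureFunction {n : ℕ} (Γ : Set (Fin n → ℝ)) (γ : (Fin n → ℝ) → ℝ) (α : ℝ) :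
    Prop where
  cone : IsAdmissibleCone Γ
  alpha_pos : 0 < α
  pos : ∀ l ∈ Γ, 0 < γ l
  smooth : ContDiffOn ℝ ∞ γ Γ
  symm : ∀ l ∈ Γ, ∀ σ : Equiv.Perm (Fin n), γ (l ∘ σ) = γ l
  partial_pos : ∀ l ∈ Γ, ∀ i : Fin n, 0 < fderiv ℝ γ l (Pi.single i 1)
  homogeneous : ∀ l ∈ Γ, ∀ c : ℝ, 0 < c → γ (c • l) = c ^ α * γ l

/-- `k`-nondegeneracy: `(0, …, 0, 1, …, 1)`, with `k` zeros, belongs to `Γ`. -/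
def IsNondegenerate {n : ℕ} (Γ : Set (Fin n → ℝ)) (k : ℕ) : Prop := zerosOnes n k ∈ Γ

/-- The two-variable restriction `γ̃(x, y) = γ(x, y, …, y)`. -/
def restrict {n : ℕ} (γ : (Fin n → ℝ) → ℝ) (x y : ℝ) : ℝ := γ (axial n x y)

open Classical in
/-- The implicit function `x = g₊(y, z)` of `γ̃(x, y) = z`, with values `x ≥ 0`; the value `x = 0`
is the continuous extension to the upper endpoint `y ^ α = z / γ̃(0, 1)` of its domain. For `y > 0`
there is at most one such `x`, because `γ̃` is strictly increasing in `x`. Where no such `x` exists,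
the (irrelevant) value is `0`. -/
noncomputable def gPlus {n : ℕ} (Γ : Set (Fin n → ℝ)) (γ : (Fin n → ℝ) → ℝ) (y z : ℝ) : ℝ :=
  if h : ∃ x : ℝ, 0 ≤ x ∧ axial n x y ∈ Γ ∧ restrict γ x y = z then h.choose else 0

/-- `β = (α - 1) / (2 α)`. -/
noncomputable def beta (α : ℝ) : ℝ := (α - 1) / (2 * α)

/-- The first argument `v / (r (1 + v²)^β)` of `g₊` in the slope equation. -/
noncomputable def slopeArg (α r v : ℝ) : ℝ := v / (r * (1 + v ^ 2) ^ beta α)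

/-- `v` is a solution on `[r₀, ∞)` of the slope equation
`v' = (1 + v²)^(β + 1) g₊(v / (r (1 + v²)^β), 1)`. The derivative at `r₀` is one-sided; if `r₀ = 0`
(where the right-hand side is not defined) the equation is required on `(0, ∞)` only, together with
continuity of `v` at `0`. -/
def IsSlopeSolution {n : ℕ} (Γ : Set (Fin n → ℝ)) (γ : (Fin n → ℝ) → ℝ) (α r₀ : ℝ) (v : ℝ → ℝ) :
    Prop :=
  ContinuousOn v (Set.Ici r₀) ∧
    ∀ r, r₀ ≤ r → 0 < r →
      HasDerivWithinAt v ((1 + v r ^ 2) ^ (beta α + 1) * gPlus Γ γ (slopeArg α r (v r)) 1)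
        (Set.Ici r₀) r

/-- The closed interval `[γ̃(1,1)^(-1/α), γ̃(0,1)^(-1/α)]` of admissible initial arguments. -/
noncomputable def admissibleInterval {n : ℕ} (γ : (Fin n → ℝ) → ℝ) (α : ℝ) : Set ℝ :=
  Set.Icc (1 / restrict γ 1 1 ^ (1 / α)) (1 / restrict γ 0 1 ^ (1 / α))

/-- Admissible initial data at `r₀ ≥ 0`: the quotient `v₀ / (r₀ (1 + v₀²)^β)` with `v₀ = v(r₀)`
lies in the admissible interval. For `r₀ = 0` the quotient is understood as the limit of
`v(r) / (r (1 + v(r)²)^β)` as `r → 0⁺` (which forces `v(0) = 0` for `v` continuous at `0`). -/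
def HasAdmissibleStart {n : ℕ} (γ : (Fin n → ℝ) → ℝ) (α r₀ : ℝ) (v : ℝ → ℝ) : Prop :=
  (0 < r₀ ∧ slopeArg α r₀ (v r₀) ∈ admissibleInterval γ α) ∨
    (r₀ = 0 ∧ ∃ y₀ ∈ admissibleInterval γ α,
      Tendsto (fun r => slopeArg α r (v r)) (𝓝[>] 0) (𝓝 y₀))

/-- `∂_y g₊(1, 1)`. For a normalized `γ` the point `y = 1` is the right endpoint of the domain of
`g₊(·, 1)`, so the derivative is the one from the left. -/
noncomputable def gPlusDeriv {n : ℕ} (Γ : Set (Fin n → ℝ)) (γ : (Fin n → ℝ) → ℝ) : ℝ :=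
  derivWithin (fun y => gPlus Γ γ y 1) (Set.Iic 1) 1

/-- `∂_y² g₊(1, 1)`, again from the left. -/
noncomputable def gPlusDeriv2 {n : ℕ} (Γ : Set (Fin n → ℝ)) (γ : (Fin n → ℝ) → ℝ) : ℝ :=
  iteratedDerivWithin 2 (fun y => gPlus Γ γ y 1) (Set.Iic 1) 1

/-- The coefficient `a`, as a function of `α` and `g₁ = ∂_y g₊(1, 1)`. -/
noncomputable def coeffA (α g₁ : ℝ) : ℝ := -α * (α / g₁ + beta α)

/-- The coefficient `b`, as a function of `α`, `g₁ = ∂_y g₊(1, 1)` and `g₂ = ∂_y² g₊(1, 1)`. -/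
noncomputable def coeffB (α g₁ g₂ : ℝ) : ℝ :=
  (2 * coeffA α g₁ * α ^ 2
      - α * g₁ * ((1 - 2 * coeffA α g₁) * beta α * (1 + beta α * (1 - 2 * coeffA α g₁))
          - 2 * coeffA α g₁ ^ 2 * beta α))
      / (2 * α * g₁ * (1 - 2 * beta α))
    + (g₁ * (coeffA α g₁ / α + beta α) * (3 * α - 1) * (1 - 2 * coeffA α g₁)
        - α * g₂ * (coeffA α g₁ / α + beta α) ^ 2)
      / (2 * α * g₁ * (1 - 2 * beta α))

end Translator

open Translator

namespace Translator

/-! By homogeneity the level set `γ̃ = 1` is parametrised by the ratio `t = x / y`: there `y = γ̃(t,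
1)^(-1/α)`, which is strictly decreasing in `t` and smooth across `t = 0` because `(0, 1, …, 1)` is
interior to `Γ`. Inverting it gives `g₊(y, 1) = y T(y)` to the left of `y = 1`, with `T` smooth,
`T(1) = 0`, `T'(1) < 0`.

Along a solution the slope argument `y = v / (r (1 + v²)^β)` satisfies `r y' = (1 + v²/α) g₊(y, 1) -
y`. Barriers keep `y` above a positive constant (`le_slopeArg`), which forces `v → ∞`
(`tendsto_slope_atTop`) and then `y → 1` from the left (`tendsto_slopeArg`).

With `w = 1/v²` one has `r w' = -2 (1 + w) T(y)`, while the equation for `y` carries a factor `1/w`: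
`y` is fast, `w` is slow. Since `T'(1) < 0`, `y` relaxes to a curve `1 + c₁ w + c₂ w²` up to
`O(w³)`, with `c₁`, `c₂` found by matching orders (`isJet_of_slow_fast`).

Finally `v / r^α = (1 + w)^(αβ) y^α` and `r^(-2α) = w (v / r^α)²` hold exactly, so the expansion in
`w` becomes one in `r^(-2α)` (`slope_expansion`). -/

/-! ### Second-order jets along a filter -/

theorem taylor_two_isBigO {f : ℝ → ℝ} {x₀ : ℝ} (hf : ContDiffAt ℝ 3 f x₀) :
    (fun x => f x - (f x₀ + deriv f x₀ * (x - x₀) + iteratedDeriv 2 f x₀ / 2 * (x - x₀) ^ 2))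
      =O[𝓝 x₀] fun x => (x - x₀) ^ 3 := by
  obtain ⟨u, hu, hfu⟩ := hf.contDiffOn (m := 3) le_rfl (by simp)
  obtain ⟨ε, hε, hball⟩ := Metric.mem_nhds_iff.1 hu
  have hx : x₀ ∈ Metric.ball x₀ ε := Metric.mem_ball_self hε
  have key := taylor_isLittleO (n := 3) (convex_ball x₀ ε) hx (hfu.mono hball)
  rw [Metric.isOpen_ball.nhdsWithin_eq hx] at key
  have h1 : iteratedDerivWithin 1 f (Metric.ball x₀ ε) x₀ = deriv f x₀ := by
    rw [iteratedDerivWithin_of_isOpen Metric.isOpen_ball hx, iteratedDeriv_one]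
  have h2 : iteratedDerivWithin 2 f (Metric.ball x₀ ε) x₀ = iteratedDeriv 2 f x₀ :=
    iteratedDerivWithin_of_isOpen Metric.isOpen_ball hx
  simp only [taylorWithinEval_succ, taylor_within_zero_eval, zero_add, h1, Nat.reduceAdd, h2] at key
  -- The third-order Taylor term is absorbed into the error, turning a little-o at order 3 into a
  -- big-O.
  have := key.isBigO.add (isBigO_const_mul_self
    (iteratedDerivWithin 3 f (Metric.ball x₀ ε) x₀ / 6) (fun x => (x - x₀) ^ 3) (𝓝 x₀))
  refine this.congr_left fun x => ?_
  simp [Nat.factorial]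
  ring

/-- `f = a + b w + c w² + O(w³)` along `l`. -/
def IsJet {ι : Type*} (l : Filter ι) (w f : ι → ℝ) (a b c : ℝ) : Prop :=
  (fun x => f x - (a + b * w x + c * w x ^ 2)) =O[l] fun x => w x ^ 3

namespace IsJet

variable {ι : Type*} {l : Filter ι} {w f g : ι → ℝ} {a b c a' b' c' : ℝ}

theorem const (a : ℝ) : IsJet l w (fun _ => a) a 0 0 := by
  simp [IsJet, isBigO_zero]

theorem self : IsJet l w w 0 1 0 := by
  simp [IsJet, isBigO_zero]

theorem add (hf : IsJet l w f a b c) (hg : IsJet l w g a' b' c') :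
    IsJet l w (fun x => f x + g x) (a + a') (b + b') (c + c') :=
  (IsBigO.add hf hg).congr_left fun x => by ring

theorem const_mul (k : ℝ) (hf : IsJet l w f a b c) :
    IsJet l w (fun x => k * f x) (k * a) (k * b) (k * c) :=
  (IsBigO.const_mul_left hf k).congr_left fun x => by ring

theorem sub (hf : IsJet l w f a b c) (hg : IsJet l w g a' b' c') :
    IsJet l w (fun x => f x - g x) (a - a') (b - b') (c - c') :=
  (IsBigO.sub hf hg).congr_left fun x => by ring

theorem tendsto_poly (hw : Tendsto w l (𝓝 0)) (a b c : ℝ) :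
    Tendsto (fun x => a + b * w x + c * w x ^ 2) l (𝓝 a) := by
  have := (tendsto_const_nhds (x := a)).add
    (((tendsto_const_nhds (x := b)).mul hw).add ((tendsto_const_nhds (x := c)).mul (hw.pow 2)))
  simpa [add_assoc] using this

theorem tendsto (hw : Tendsto w l (𝓝 0)) (hf : IsJet l w f a b c) : Tendsto f l (𝓝 a) := by
  have h3 : Tendsto (fun x => w x ^ 3) l (𝓝 0) := by simpa using hw.pow 3
  have := (IsBigO.trans_tendsto hf h3).add (tendsto_poly hw a b c)
  simpa using this

theorem mul (hw : Tendsto w l (𝓝 0)) (hf : IsJet l w f a b c) (hg : IsJet l w g a' b' c') :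
    IsJet l w (fun x => f x * g x) (a * a') (a * b' + b * a') (a * c' + b * b' + c * a') := by
  have h1 := IsBigO.mul hf ((hg.tendsto hw).isBigO_one ℝ)
  have h2 := IsBigO.mul ((tendsto_poly hw a b c).isBigO_one ℝ) hg
  -- The terms of degree 3 and 4 in the product of the two polynomials, divided by `w³`.
  have hw1 : Tendsto (fun x => b * c' + c * b' + c * c' * w x) l (𝓝 (b * c' + c * b')) := by
    simpa using tendsto_poly hw (b * c' + c * b') (c * c') 0
  have h3 := (hw1.isBigO_one ℝ).mul (isBigO_refl (fun x => w x ^ 3) l)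
  simp only [mul_one, one_mul] at h1 h2 h3
  exact ((h1.add h2).add h3).congr_left fun x => by ring

theorem isBigO_self (hw : Tendsto w l (𝓝 0)) (hf : IsJet l w f 0 b c) : f =O[l] w := by
  have hw2 : Tendsto (fun x => w x ^ 2) l (𝓝 0) := by simpa using hw.pow 2
  have h3 : (fun x => w x ^ 3) =O[l] w :=
    ((hw2.isBigO_one ℝ).mul (isBigO_refl w l)).congr (fun x => by ring) fun x => by ring
  have h4 : (fun x => 0 + b * w x + c * w x ^ 2) =O[l] w :=
    ((((tendsto_poly hw b c 0).isBigO_one ℝ)).mul (isBigO_refl w l)).congr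
      (fun x => by ring) fun x => by ring
  exact ((IsBigO.trans hf h3).add h4).congr_left fun x => by ring

theorem isBigO_cube (hf : IsJet l w f 0 0 0) : f =O[l] fun x => w x ^ 3 :=
  IsBigO.congr_left hf fun x => by ring

theorem comp {φ : ℝ → ℝ} (hw : Tendsto w l (𝓝 0)) (hφ : ContDiffAt ℝ 3 φ a)
    (hf : IsJet l w f a b c) :
    IsJet l w (fun x => φ (f x)) (φ a) (deriv φ a * b)
      (deriv φ a * c + iteratedDeriv 2 φ a / 2 * b ^ 2) := by
  have h1 := (taylor_two_isBigO hφ).comp_tendsto (hf.tendsto hw)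
  have hs : IsJet l w (fun x => f x - a) 0 b c := by simpa using hf.sub (const a)
  have h2 := h1.trans ((hs.isBigO_self hw).pow 3)
  have h3 := ((const (φ a)).add (hs.const_mul (deriv φ a))).add
    ((hs.mul hw hs).const_mul (iteratedDeriv 2 φ a / 2))
  exact (h2.add h3).congr_left fun x => by
    simp only [Function.comp]
    ring

theorem congr' (hf : IsJet l w f a b c) (hfg : f =ᶠ[l] g) : IsJet l w g a b c :=
  IsBigO.congr' hf (hfg.mono fun x hx => by simp only [hx]) EventuallyEq.rfl

theorem coeff_eq (hf : IsJet l w f a b c) (ha : a = a') (hb : b = b') (hc : c = c') :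
    IsJet l w f a' b' c' := by
  subst ha hb hc; exact hf

end IsJet

/-! ### Barrier and drift arguments -/

/-- A function whose derivative is negative on the level set `{f = K}` cannot leave `{f ≤ K}`. -/
theorem le_of_hasDerivAt_neg_on_level {f f' : ℝ → ℝ} {R K : ℝ}
    (hf : ∀ r, R ≤ r → HasDerivAt f (f' r) r) (hR : f R ≤ K)
    (hK : ∀ r, R ≤ r → f r = K → f' r < 0) : ∀ r, R ≤ r → f r ≤ K := fun r hr =>
  image_le_of_deriv_right_lt_deriv_boundary (a := R) (b := r) (B := fun _ => K) (B' := fun _ => 0)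
    (fun x hx => (hf x hx.1).continuousAt.continuousWithinAt)
    (fun x hx => (hf x hx.1).hasDerivWithinAt) hR (fun x => hasDerivAt_const x K)
    (fun x hx h => hK x hx.1 h) ⟨hr, le_rfl⟩

/-- If `r f'(r)` is bounded above by a negative constant on `{f ≥ K}`, then `f ≤ K` eventually. -/
theorem eventually_le_of_drift {f f' : ℝ → ℝ} {R K c : ℝ} (hR : 0 < R) (hc : 0 < c)
    (hf : ∀ r, R ≤ r → HasDerivAt f (f' r) r)
    (hK : ∀ r, R ≤ r → K ≤ f r → f' r ≤ -c / r) : ∀ᶠ r in atTop, f r ≤ K := by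
  obtain ⟨r₁, hr₁, hfr₁⟩ : ∃ r₁, R ≤ r₁ ∧ f r₁ ≤ K := by
    by_contra! hcon
    -- If `f` stayed above `K`, then `f + c log r` would be nonincreasing, although `c log r` is
    -- unbounded.
    have hd : ∀ r, R ≤ r → HasDerivAt (fun r => f r + c * Real.log r) (f' r + c * r⁻¹) r :=
      fun r hr => (hf r hr).add ((Real.hasDerivAt_log (hR.trans_le hr).ne').const_mul c)
    have hanti : AntitoneOn (fun r => f r + c * Real.log r) (Set.Ici R) := by
      refine antitoneOn_of_deriv_nonpos (convex_Ici R)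
        (fun x hx => (hd x hx).continuousAt.continuousWithinAt)
        (fun x hx => (hd x (interior_subset hx)).differentiableAt.differentiableWithinAt)
        fun x hx => ?_
      have hx' : R ≤ x := interior_subset hx
      rw [(hd x hx').deriv]
      have := hK x hx' (hcon x hx').le
      rw [neg_div, div_eq_mul_inv] at this
      linarith
    have hlog : Tendsto (fun r => c * Real.log r) atTop atTop :=
      Real.tendsto_log_atTop.const_mul_atTop hc
    obtain ⟨r, h1, h2⟩ := ((hlog.eventually_gt_atTop (f R + c * Real.log R - K)).and
      (eventually_ge_atTop R)).exists
    have h3 := hanti (Set.mem_Ici.2 le_rfl) (Set.mem_Ici.2 h2) h2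
    have h4 := hcon r h2
    simp only at h3
    linarith
  filter_upwards [eventually_ge_atTop r₁] with r hr
  refine le_of_hasDerivAt_neg_on_level (fun s hs => hf s (hr₁.trans hs)) hfr₁
    (fun s hs hsK => ?_) r hr
  have hs0 : 0 < s := hR.trans_le (hr₁.trans hs)
  refine (hK s (hr₁.trans hs) hsK.ge).trans_lt ?_
  rw [neg_div]
  exact neg_neg_of_pos (by positivity)

/-! ### The level curve `γ̃ = 1` and the function `g₊(·, 1)` -/

section Profile

variable {n : ℕ} {Γ : Set (Fin n → ℝ)} {γ : (Fin n → ℝ) → ℝ} {α : ℝ}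

theorem axial_eq_add_smul_single (hn : 2 ≤ n) (x y : ℝ) :
    axial n x y = axial n 0 y + x • Pi.single (⟨0, by omega⟩ : Fin n) (1 : ℝ) := by
  funext i
  by_cases hi : (i : ℕ) = 0
  · have : i = ⟨0, by omega⟩ := Fin.ext hi
    simp [this, axial]
  · have : i ≠ ⟨0, by omega⟩ := fun h => hi (by rw [h])
    simp [axial, hi, this]

theorem axial_mul (n : ℕ) (t y : ℝ) : axial n (y * t) y = y • axial n t 1 := by
  funext i
  by_cases hi : (i : ℕ) = 0 <;> simp [axial, hi]

theorem axial_mem (hγ : IsCurvatureFunction Γ γ α) (hnd : IsNondegenerate Γ 1) {x y : ℝ}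
    (hx : 0 ≤ x) (hy : 0 < y) : axial n x y ∈ Γ := by
  rcases hx.eq_or_lt with rfl | hx
  · have h : axial n 0 1 = zerosOnes n 1 := by
      funext i
      simp [axial, zerosOnes]
    have h2 := hγ.cone.smul_mem _ (h ▸ hnd : axial n 0 1 ∈ Γ) y hy
    rwa [← axial_mul, mul_zero] at h2
  · exact hγ.cone.pos_mem _ fun i => by
      unfold axial
      split_ifs <;> assumption

theorem restrict_mul (hγ : IsCurvatureFunction Γ γ α) (hnd : IsNondegenerate Γ 1) {t y : ℝ}
    (ht : 0 ≤ t) (hy : 0 < y) : restrict γ (y * t) y = y ^ α * restrict γ t 1 := by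
  unfold restrict
  rw [axial_mul, hγ.homogeneous _ (axial_mem hγ hnd ht one_pos) _ hy]

theorem restrict_pos (hγ : IsCurvatureFunction Γ γ α) (hnd : IsNondegenerate Γ 1) {t : ℝ}
    (ht : 0 ≤ t) : 0 < restrict γ t 1 :=
  hγ.pos _ (axial_mem hγ hnd ht one_pos)

/-- Nondegeneracy puts `(0, 1, …, 1)` in the open set `Γ`, so smoothness is two-sided even at `t =
0`; this is what later permits inversion at the endpoint. -/
theorem contDiffAt_restrict (hn : 2 ≤ n) (hγ : IsCurvatureFunction Γ γ α)
    (hnd : IsNondegenerate Γ 1) {t : ℝ} (ht : 0 ≤ t) :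
    ContDiffAt ℝ ∞ (fun t => restrict γ t 1) t := by
  have h1 : ContDiffAt ℝ ∞ γ (axial n t 1) :=
    hγ.smooth.contDiffAt (hγ.cone.isOpen.mem_nhds (axial_mem hγ hnd ht one_pos))
  have h2 : ContDiffAt ℝ ∞ (fun t => axial n t 1) t := by
    rw [show (fun t => axial n t 1) = _ from funext fun t => axial_eq_add_smul_single hn t 1]
    fun_prop
  exact h1.comp t h2

theorem deriv_restrict_pos (hn : 2 ≤ n) (hγ : IsCurvatureFunction Γ γ α)
    (hnd : IsNondegenerate Γ 1) {t : ℝ} (ht : 0 ≤ t) :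
    0 < deriv (fun t => restrict γ t 1) t := by
  have hmem := axial_mem hγ hnd ht one_pos
  have h1 : HasFDerivAt γ (fderiv ℝ γ (axial n t 1)) (axial n t 1) :=
    ((hγ.smooth.contDiffAt (hγ.cone.isOpen.mem_nhds hmem)).differentiableAt
      (by simp)).hasFDerivAt
  have h2 : HasDerivAt (fun t => axial n t 1) (Pi.single (⟨0, by omega⟩ : Fin n) (1 : ℝ)) t := by
    rw [show (fun t => axial n t 1) = _ from funext fun t => axial_eq_add_smul_single hn t 1]
    simpa using ((hasDerivAt_id t).smul_const
      (Pi.single (⟨0, by omega⟩ : Fin n) (1 : ℝ))).const_add (axial n 0 1)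
  have h3 : HasDerivAt (fun t => restrict γ t 1) _ t := h1.comp_hasDerivAt t h2
  rw [h3.deriv]
  exact hγ.partial_pos _ hmem _

theorem strictMonoOn_restrict (hn : 2 ≤ n) (hγ : IsCurvatureFunction Γ γ α)
    (hnd : IsNondegenerate Γ 1) : StrictMonoOn (fun t => restrict γ t 1) (Set.Ici 0) :=
  strictMonoOn_of_deriv_pos (convex_Ici 0)
    (fun _ ht => (contDiffAt_restrict hn hγ hnd ht).continuousAt.continuousWithinAt)
    fun _ ht => deriv_restrict_pos hn hγ hnd (interior_subset ht)

/-- The value `y` for which `γ̃(y t, y) = 1`. -/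
noncomputable def profile (γ : (Fin n → ℝ) → ℝ) (α t : ℝ) : ℝ := restrict γ t 1 ^ (-(1 / α))

theorem profile_pos (hγ : IsCurvatureFunction Γ γ α) (hnd : IsNondegenerate Γ 1) {t : ℝ}
    (ht : 0 ≤ t) : 0 < profile γ α t :=
  Real.rpow_pos_of_pos (restrict_pos hγ hnd ht) _

theorem profile_rpow (hγ : IsCurvatureFunction Γ γ α) (hnd : IsNondegenerate Γ 1) {t : ℝ}
    (ht : 0 ≤ t) : profile γ α t ^ α = (restrict γ t 1)⁻¹ := by
  have hα := hγ.alpha_pos.ne'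
  unfold profile
  rw [← Real.rpow_mul (restrict_pos hγ hnd ht).le, ← Real.rpow_neg_one]
  congr 1
  field_simp

theorem profile_zero (hnorm : restrict γ 0 1 = 1) : profile γ α 0 = 1 := by
  simp [profile, hnorm]

theorem contDiffAt_profile (hn : 2 ≤ n) (hγ : IsCurvatureFunction Γ γ α)
    (hnd : IsNondegenerate Γ 1) {t : ℝ} (ht : 0 ≤ t) : ContDiffAt ℝ ∞ (profile γ α) t :=
  (contDiffAt_restrict hn hγ hnd ht).rpow_const_of_ne (restrict_pos hγ hnd ht).ne'

theorem deriv_profile_neg (hn : 2 ≤ n) (hγ : IsCurvatureFunction Γ γ α)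
    (hnd : IsNondegenerate Γ 1) {t : ℝ} (ht : 0 ≤ t) : deriv (profile γ α) t < 0 := by
  have h1 := ((contDiffAt_restrict hn hγ hnd ht).differentiableAt (by simp)).hasDerivAt
  have h2 : HasDerivAt (profile γ α) _ t :=
    h1.rpow_const (p := -(1 / α)) (Or.inl (restrict_pos hγ hnd ht).ne')
  rw [h2.deriv]
  have := deriv_restrict_pos hn hγ hnd ht
  have hp := Real.rpow_pos_of_pos (restrict_pos hγ hnd ht) (-(1 / α) - 1)
  have hα := one_div_pos.2 hγ.alpha_pos
  have := mul_pos (mul_pos this hα) hp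
  linarith

theorem strictAntiOn_profile (hn : 2 ≤ n) (hγ : IsCurvatureFunction Γ γ α)
    (hnd : IsNondegenerate Γ 1) : StrictAntiOn (profile γ α) (Set.Ici 0) :=
  strictAntiOn_of_deriv_neg (convex_Ici 0)
    (fun _ ht => (contDiffAt_profile hn hγ hnd ht).continuousAt.continuousWithinAt)
    fun _ ht => deriv_profile_neg hn hγ hnd (interior_subset ht)

theorem gPlus_nonneg (y z : ℝ) : 0 ≤ gPlus Γ γ y z := by
  unfold gPlus
  split_ifs with h
  · exact h.choose_spec.1
  · exact le_rfl

/-- Homogeneity makes `x = y t` a solution; strict monotonicity in the ratio `x / y` identifies the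
chosen solution with it. -/
theorem gPlus_profile (hn : 2 ≤ n) (hγ : IsCurvatureFunction Γ γ α)
    (hnd : IsNondegenerate Γ 1) {t : ℝ} (ht : 0 ≤ t) :
    gPlus Γ γ (profile γ α t) 1 = profile γ α t * t := by
  have hy := profile_pos hγ hnd ht
  have hh := restrict_pos hγ hnd ht
  have hex : ∃ x : ℝ, 0 ≤ x ∧ axial n x (profile γ α t) ∈ Γ ∧
      restrict γ x (profile γ α t) = 1 :=
    ⟨profile γ α t * t, by positivity, axial_mem hγ hnd (by positivity) hy, by
      rw [restrict_mul hγ hnd ht hy, profile_rpow hγ hnd ht, inv_mul_cancel₀ hh.ne']⟩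
  unfold gPlus
  rw [dif_pos hex]
  obtain ⟨hx, -, hx1⟩ := hex.choose_spec
  set x := hex.choose
  have hs : 0 ≤ x / profile γ α t := by positivity
  have hxs : x = profile γ α t * (x / profile γ α t) := by field_simp
  rw [hxs, restrict_mul hγ hnd hs hy, profile_rpow hγ hnd ht] at hx1
  have : restrict γ (x / profile γ α t) 1 = restrict γ t 1 := by
    field_simp at hx1
    exact hx1
  rw [hxs, (strictMonoOn_restrict hn hγ hnd).injOn hs ht this]

theorem gPlus_eq_zero_of_one_le (hn : 2 ≤ n) (hγ : IsCurvatureFunction Γ γ α)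
    (hnd : IsNondegenerate Γ 1) (hnorm : restrict γ 0 1 = 1) {y : ℝ} (hy : 1 ≤ y) :
    gPlus Γ γ y 1 = 0 := by
  rcases hy.eq_or_lt with rfl | hy
  · simpa [profile_zero hnorm] using gPlus_profile hn hγ hnd le_rfl
  -- Here `γ̃(x, y) ≥ y^α > 1` for all `x ≥ 0`, so no solution exists and the default value `0`
  -- applies.
  · refine dif_neg ?_
    rintro ⟨x, hx, -, hx1⟩
    have hy0 : 0 < y := one_pos.trans hy
    have hs : 0 ≤ x / y := by positivity
    have hxs : x = y * (x / y) := by field_simp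
    rw [hxs, restrict_mul hγ hnd hs hy0] at hx1
    have h1 := (strictMonoOn_restrict hn hγ hnd).monotoneOn (Set.mem_Ici.2 le_rfl) hs hs
    simp only [hnorm] at h1
    have h2 := Real.one_lt_rpow hy hγ.alpha_pos
    nlinarith

theorem exists_profile_eq (hn : 2 ≤ n) (hγ : IsCurvatureFunction Γ γ α)
    (hnd : IsNondegenerate Γ 1) (hnorm : restrict γ 0 1 = 1) {s y : ℝ} (hs : 0 ≤ s)
    (h1 : profile γ α s ≤ y) (h2 : y ≤ 1) : ∃ t, 0 ≤ t ∧ t ≤ s ∧ profile γ α t = y := by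
  have hc : ContinuousOn (profile γ α) (Set.Icc 0 s) := fun t ht =>
    (contDiffAt_profile hn hγ hnd ht.1).continuousAt.continuousWithinAt
  obtain ⟨t, ht, hty⟩ := intermediate_value_Icc' hs hc ⟨h1, (profile_zero hnorm).symm ▸ h2⟩
  exact ⟨t, ht.1, ht.2, hty⟩

theorem exists_pos_mul_le_gPlus (hn : 2 ≤ n) (hγ : IsCurvatureFunction Γ γ α)
    (hnd : IsNondegenerate Γ 1) (hnorm : restrict γ 0 1 = 1) {s z : ℝ} (hs : 0 ≤ s)
    (h1 : profile γ α s ≤ z) (h2 : z < 1) :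
    ∃ c, 0 < c ∧ ∀ y, profile γ α s ≤ y → y ≤ z → c * y ≤ gPlus Γ γ y 1 := by
  -- The constant is the ratio `x / y` belonging to `z`; smaller `y` have larger ratios.
  obtain ⟨c, hc0, -, rfl⟩ := exists_profile_eq hn hγ hnd hnorm hs h1 h2.le
  refine ⟨c, hc0.lt_of_ne ?_, fun y hy1 hy2 => ?_⟩
  · rintro rfl
    simp [profile_zero hnorm] at h2
  · obtain ⟨t, ht0, -, rfl⟩ := exists_profile_eq hn hγ hnd hnorm hs hy1 (hy2.trans h2.le)
    have hct : c ≤ t := ((strictAntiOn_profile hn hγ hnd).le_iff_ge ht0 hc0).1 hy2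
    rw [gPlus_profile hn hγ hnd ht0, mul_comm]
    exact mul_le_mul_of_nonneg_left hct (profile_pos hγ hnd ht0).le

/-- Near `y = 1`, on the left, `g₊(y, 1) = y T(y)` with `T` smooth. -/
theorem exists_smooth_gPlus (hn : 2 ≤ n) (hγ : IsCurvatureFunction Γ γ α)
    (hnd : IsNondegenerate Γ 1) (hnorm : restrict γ 0 1 = 1) :
    ∃ T : ℝ → ℝ, ContDiffAt ℝ ∞ T 1 ∧ T 1 = 0 ∧ deriv T 1 < 0 ∧
      (fun y => gPlus Γ γ y 1) =ᶠ[𝓝[≤] 1] fun y => y * T y := by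
  have hY := contDiffAt_profile hn hγ hnd (le_refl (0 : ℝ))
  have hd := deriv_profile_neg hn hγ hnd (le_refl (0 : ℝ))
  have hY0 : profile γ α 0 = 1 := profile_zero hnorm
  have hs : HasStrictDerivAt (profile γ α) (deriv (profile γ α) 0) 0 :=
    hY.hasStrictDerivAt (by simp)
  have hF := hs.hasStrictFDerivAt_equiv hd.ne
  have hT0 := hY.localInverse_apply_image hF.hasFDerivAt (by simp)
  have hTs := hY.to_localInverse hF.hasFDerivAt (by simp)
  have hTd : HasStrictDerivAt (hY.localInverse hF.hasFDerivAt (by simp))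
    (deriv (profile γ α) 0)⁻¹ (profile γ α 0) := hs.to_localInverse hd.ne
  have hTr : ∀ᶠ y in 𝓝 (profile γ α 0),
      profile γ α (hY.localInverse hF.hasFDerivAt (by simp) y) = y :=
    hs.eventually_right_inverse hd.ne
  set T := hY.localInverse hF.hasFDerivAt (by simp)
  rw [hY0] at hT0 hTs hTd hTr
  have hTneg : deriv T 1 < 0 := by
    rw [hTd.hasDerivAt.deriv]
    exact inv_lt_zero.2 hd
  refine ⟨T, hTs, hT0, hTneg, ?_⟩
  -- Only where `T ≥ 0`, that is to the left of `1`, does the local inverse give an admissible `x`.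
  have hsign := eventually_nhdsWithin_sign_eq_of_deriv_neg hTneg hT0
  refine eventually_nhdsWithin_iff.2 ?_
  filter_upwards [hsign, hTr] with y h1 h2 hy
  have hTy : 0 ≤ T y := by
    rcases (show y ≤ 1 from hy).eq_or_lt with rfl | hlt
    · exact hT0.ge
    · have := h1
      rw [sign_pos (sub_pos.2 hlt), sign_eq_one_iff] at this
      exact this.le
  have := gPlus_profile hn hγ hnd hTy
  rwa [h2] at this

theorem lt_one_div_rpow_restrict (hn : 2 ≤ n) (hγ : IsCurvatureFunction Γ γ α)
    (hnd : IsNondegenerate Γ 1) : profile γ α 2 < 1 / restrict γ 1 1 ^ (1 / α) := by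
  have := strictAntiOn_profile hn hγ hnd (show (1 : ℝ) ∈ Set.Ici 0 by simp)
    (show (2 : ℝ) ∈ Set.Ici 0 by simp) (by norm_num)
  rwa [one_div (_ ^ _), ← Real.rpow_neg (restrict_pos hγ hnd zero_le_one).le]

end Profile

/-! ### One-sided derivatives of `g₊(·, 1)` at the endpoint -/

section Profile

variable {n : ℕ} {Γ : Set (Fin n → ℝ)} {γ : (Fin n → ℝ) → ℝ} {T : ℝ → ℝ}

theorem two_le_infty : (2 : WithTop ℕ∞) ≤ ∞ :=
  WithTop.coe_le_coe.2 (le_top : (2 : ℕ∞) ≤ ⊤)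

theorem contDiffAt_id_mul (hT : ContDiffAt ℝ ∞ T 1) : ContDiffAt ℝ ∞ (fun y => y * T y) 1 :=
  contDiffAt_id.mul hT

theorem contDiffWithinAt_gPlus (hT : ContDiffAt ℝ ∞ T 1)
    (h : (fun y => gPlus Γ γ y 1) =ᶠ[𝓝[≤] 1] fun y => y * T y) :
    ContDiffWithinAt ℝ 2 (fun y => gPlus Γ γ y 1) (Set.Iic 1) 1 :=
  (((contDiffAt_id_mul hT).of_le (m := 2) two_le_infty).contDiffWithinAt).congr_of_eventuallyEq
    h (h.self_of_nhdsWithin Set.self_mem_Iic)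

theorem hasDerivAt_id_mul {y : ℝ} (hT : DifferentiableAt ℝ T y) :
    HasDerivAt (fun y => y * T y) (T y + y * deriv T y) y := by
  exact ((hasDerivAt_id y).mul hT.hasDerivAt).congr_deriv (by simp)

theorem gPlusDeriv_eq (hT : ContDiffAt ℝ ∞ T 1) (hT0 : T 1 = 0)
    (h : (fun y => gPlus Γ γ y 1) =ᶠ[𝓝[≤] 1] fun y => y * T y) :
    gPlusDeriv Γ γ = deriv T 1 := by
  have h1 := hasDerivAt_id_mul (hT.differentiableAt (by simp))
  rw [gPlusDeriv, h.derivWithin_eq (h.self_of_nhdsWithin Set.self_mem_Iic),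
    h1.hasDerivWithinAt.derivWithin (uniqueDiffOn_Iic 1 1 Set.self_mem_Iic), hT0]
  ring

theorem gPlusDeriv2_eq (hT : ContDiffAt ℝ ∞ T 1)
    (h : (fun y => gPlus Γ γ y 1) =ᶠ[𝓝[≤] 1] fun y => y * T y) :
    gPlusDeriv2 Γ γ = 2 * deriv T 1 + iteratedDeriv 2 T 1 := by
  have hd : ∀ᶠ y in 𝓝 1, DifferentiableAt ℝ T y :=
    ((hT.of_le (m := 1) (by exact_mod_cast le_top)).eventually (by simp)).mono
      fun y hy => hy.differentiableAt (by simp)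
  have hdd : DifferentiableAt ℝ (deriv T) 1 :=
    ((hT.fderiv_right (m := 1) two_le_infty).differentiableAt (by simp)).clm_apply
      (differentiableAt_const (1 : ℝ))
  have h1 : deriv (fun y => y * T y) =ᶠ[𝓝 1] fun y => T y + y * deriv T y :=
    hd.mono fun y hy => (hasDerivAt_id_mul hy).deriv
  rw [gPlusDeriv2, h.iteratedDerivWithin_eq (h.self_of_nhdsWithin Set.self_mem_Iic),
    iteratedDerivWithin_eq_iteratedDeriv (uniqueDiffOn_Iic 1)
      ((contDiffAt_id_mul hT).of_le two_le_infty) Set.self_mem_Iic]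
  simp only [iteratedDeriv_succ, iteratedDeriv_zero]
  have h2 : HasDerivAt (fun y => T y + y * deriv T y) _ 1 :=
    (hT.differentiableAt (by simp)).hasDerivAt.add (hasDerivAt_id_mul hdd)
  rw [h1.deriv_eq, h2.deriv]
  ring

end Profile

/-! ### The equation for the slope argument and its limit -/

theorem one_sub_two_mul_beta {α : ℝ} (hα : 0 < α) : 1 - 2 * beta α = 1 / α := by
  unfold beta
  field_simp
  ring

/-- The derivative of `v (1 + v²)^(-β)` in `v` is `(1 + v²)^(-β-1) (1 + (1 - 2β) v²)`, whose power
cancels the one in the slope equation. -/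
theorem hasDerivAt_slopeArg {α r G : ℝ} {v : ℝ → ℝ} (hr : 0 < r)
    (hv : HasDerivAt v ((1 + v r ^ 2) ^ (beta α + 1) * G) r) :
    HasDerivAt (fun r => slopeArg α r (v r))
      (((1 + (1 - 2 * beta α) * v r ^ 2) * G - slopeArg α r (v r)) / r) r := by
  have hp : 0 < 1 + v r ^ 2 := by positivity
  have h1 := ((hv.pow 2).const_add 1).rpow_const (p := beta α) (Or.inl hp.ne')
  have hne : r * (1 + v r ^ 2) ^ beta α ≠ 0 := by positivity
  have h2 := hv.div ((hasDerivAt_id r).mul h1) hne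
  refine h2.congr_deriv ?_
  unfold slopeArg
  have hb := Real.rpow_pos_of_pos hp (beta α)
  simp only [Real.rpow_add hp, Real.rpow_sub hp, Real.rpow_one, id, Pi.mul_apply, Pi.pow_apply]
  field_simp
  push_cast
  ring

section Dynamics

variable {α R y₂ : ℝ} {v g : ℝ → ℝ}

/-- At `y = y₂` one has `r y' ≥ 2 y₂ - y₂ > 0`, so `y₂` is a lower barrier. -/
theorem le_slopeArg (hα : 0 < α) (hR : 0 < R)
    (hv : ∀ r, R ≤ r →
      HasDerivAt v ((1 + v r ^ 2) ^ (beta α + 1) * g (slopeArg α r (v r))) r)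
    (hy₂ : 0 < y₂) (hg₂ : 2 * y₂ ≤ g y₂) (hstart : y₂ ≤ slopeArg α R (v R)) :
    ∀ r, R ≤ r → y₂ ≤ slopeArg α r (v r) := by
  intro r hr
  have := le_of_hasDerivAt_neg_on_level (K := -y₂)
    (fun r hr => (hasDerivAt_slopeArg (hR.trans_le hr) (hv r hr)).neg) (neg_le_neg hstart)
    (fun s hs h => ?_) r hr
  · simpa using this
  · have h' : slopeArg α s (v s) = y₂ := neg_injective h
    have hs0 : 0 < s := hR.trans_le hs
    rw [h', one_sub_two_mul_beta hα]
    have : 0 ≤ 1 / α * v s ^ 2 := by positivity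
    refine neg_neg_of_pos (div_pos ?_ hs0)
    nlinarith

/-- As `g ≥ 0`, `v` is monotone. A finite limit would make `v / (1 + v²)^β = r y` converge, against
`r y ≥ y₂ r`. -/
theorem tendsto_slope_atTop (hR : 0 < R)
    (hv : ∀ r, R ≤ r →
      HasDerivAt v ((1 + v r ^ 2) ^ (beta α + 1) * g (slopeArg α r (v r))) r)
    (hg : ∀ y, 0 ≤ g y) (hy₂ : 0 < y₂) (hy : ∀ r, R ≤ r → y₂ ≤ slopeArg α r (v r)) :
    Tendsto v atTop atTop := by
  have hmono : MonotoneOn v (Set.Ici R) := by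
    refine monotoneOn_of_deriv_nonneg (convex_Ici R)
      (fun x hx => (hv x hx).continuousAt.continuousWithinAt)
      (fun x hx => (hv x (interior_subset hx)).differentiableAt.differentiableWithinAt)
      fun x hx => ?_
    rw [(hv x (interior_subset hx)).deriv]
    exact mul_nonneg (by positivity) (hg _)
  have hmono' : Monotone fun r => v (max r R) := fun r s hrs =>
    hmono (Set.mem_Ici.2 (le_max_right _ _)) (Set.mem_Ici.2 (le_max_right _ _)) (max_le_max_right R hrs)
  have heq : (fun r => v (max r R)) =ᶠ[atTop] v := by
    filter_upwards [eventually_ge_atTop R] with r hr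
    rw [max_eq_left hr]
  rcases tendsto_atTop_of_monotone hmono' with h | ⟨l, hl⟩
  · exact h.congr' heq
  · have hl' : Tendsto v atTop (𝓝 l) := hl.congr' heq
    have hF : Tendsto (fun r => v r / (1 + v r ^ 2) ^ beta α) atTop
        (𝓝 (l / (1 + l ^ 2) ^ beta α)) := by
      refine hl'.div (((hl'.pow 2).const_add 1).rpow_const (Or.inl (by positivity))) ?_
      positivity
    refine absurd hF (not_tendsto_nhds_of_tendsto_atTop ?_ _)
    refine tendsto_atTop_mono' _ ?_ (tendsto_id.const_mul_atTop hy₂)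
    filter_upwards [eventually_ge_atTop R] with r hr
    have hr0 : 0 < r := hR.trans_le hr
    have hp : 0 < (1 + v r ^ 2) ^ beta α := by positivity
    have h1 := mul_le_mul_of_nonneg_right (hy r hr) hr0.le
    have h2 : slopeArg α r (v r) * r = v r / (1 + v r ^ 2) ^ beta α := by
      unfold slopeArg
      field_simp
    rwa [h2] at h1

/-- Where `y ≥ 1`, `r y' = -y ≤ -1`. Where `y ≤ z < 1`, growth of `v` eventually gives `(1 + v²/α)
g(y) ≥ 2 y`, hence `r y' ≥ y ≥ y₂`. Either drift, integrated against `dr / r`, is decisive. -/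
theorem tendsto_slopeArg (hα : 0 < α) (hR : 0 < R)
    (hv : ∀ r, R ≤ r →
      HasDerivAt v ((1 + v r ^ 2) ^ (beta α + 1) * g (slopeArg α r (v r))) r)
    (hg1 : ∀ y, 1 ≤ y → g y = 0) (hy₂ : 0 < y₂)
    (hg3 : ∀ z, y₂ ≤ z → z < 1 → ∃ c, 0 < c ∧ ∀ y, y₂ ≤ y → y ≤ z → c * y ≤ g y)
    (hy : ∀ r, R ≤ r → y₂ ≤ slopeArg α r (v r)) (hvt : Tendsto v atTop atTop) :
    Tendsto (fun r => slopeArg α r (v r)) atTop (𝓝[≤] 1) := by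
  have hd := fun r hr => hasDerivAt_slopeArg (hR.trans_le hr) (hv r hr)
  have hle : ∀ᶠ r in atTop, slopeArg α r (v r) ≤ 1 := by
    refine eventually_le_of_drift hR one_pos hd fun r hr h1 => ?_
    have hr0 : 0 < r := hR.trans_le hr
    rw [hg1 _ h1]
    gcongr
    linarith
  refine tendsto_nhdsWithin_iff.2 ⟨?_, hle⟩
  rw [tendsto_order]
  refine ⟨fun z hz => ?_, fun z hz => hle.mono fun r hr => hr.trans_lt hz⟩
  obtain ⟨z', hz'⟩ := exists_between (max_lt hz (show min y₂ 0 < 1 by simp))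
  by_cases hz2 : y₂ ≤ z'
  · obtain ⟨c, hc, hcg⟩ := hg3 z' hz2 hz'.2
    have hev : ∀ᶠ r in atTop, 2 ≤ (1 + 1 / α * v r ^ 2) * c := by
      have : Tendsto (fun r => (1 + 1 / α * v r ^ 2) * c) atTop atTop :=
        (tendsto_atTop_add_const_left _ 1 (((tendsto_pow_atTop two_ne_zero).comp
          hvt).const_mul_atTop (by positivity))).atTop_mul_const hc
      exact this.eventually_ge_atTop 2
    obtain ⟨R', hR'⟩ := eventually_atTop.1 hev
    have hmain := eventually_le_of_drift (f := fun r => -slopeArg α r (v r))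
      (R := max R R') (K := -z') (lt_max_of_lt_left hR) hy₂
      (fun r hr => (hd r (le_of_max_le_left hr)).neg) fun r hr h1 => by
        have hr1 := le_of_max_le_left hr
        have hr0 : 0 < r := hR.trans_le hr1
        have hyr := hy r hr1
        have h2 := hcg _ hyr (neg_le_neg_iff.1 h1)
        have h3 := hR' r (le_of_max_le_right hr)
        rw [one_sub_two_mul_beta hα, ← neg_div]
        gcongr
        have h4 : 0 ≤ 1 + 1 / α * v r ^ 2 := by positivity
        have h5 := mul_le_mul_of_nonneg_left h2 h4
        have h6 := mul_le_mul_of_nonneg_right h3 (hy₂.le.trans hyr)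
        linarith
    exact hmain.mono fun r hr => (le_max_left _ _).trans_lt (hz'.1.trans_le (neg_le_neg_iff.1 hr))
  · filter_upwards [eventually_ge_atTop R] with r hr
    exact (le_max_left _ _).trans_lt (hz'.1.trans_le ((not_le.1 hz2).le.trans (hy r hr)))

end Dynamics

/-! ### The slow-fast system for `y` and `w = 1/v²` -/

/-- With `P` the quadratic candidate and `E = y - P`, the Lyapunov function is `(E / w³)²`. The
candidate solves the system up to `O(w³)`, and the linearised fast equation contracts at rate `m =
-κ T'(1) > 0`, so `E / w³` stays bounded. -/
theorem isJet_of_slow_fast {κ c₁ c₂ : ℝ} {T y w : ℝ → ℝ} (hκ : 0 < κ) (hT : ContDiffAt ℝ 3 T 1)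
    (hT0 : T 1 = 0) (hT1 : deriv T 1 < 0)
    (hy : Tendsto y atTop (𝓝 1)) (hw : Tendsto w atTop (𝓝 0)) (hw0 : ∀ᶠ r in atTop, 0 < w r)
    (hyd : ∀ᶠ r in atTop,
      HasDerivAt y (((1 + κ / w r) * (y r * T (y r)) - y r) / r) r)
    (hwd : ∀ᶠ r in atTop, HasDerivAt w (-(2 * (1 + w r) * T (y r)) / r) r)
    (hc₁ : κ * (deriv T 1 * c₁) = 1)
    (hc₂ : κ * (deriv T 1 * c₂ + iteratedDeriv 2 T 1 / 2 * c₁ ^ 2)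
      = -(deriv T 1 * c₁ * (1 + 2 * c₁))) :
    IsJet atTop w y 1 c₁ c₂ := by
  set t₁ := deriv T 1 with ht₁
  set P : ℝ → ℝ := fun r => 1 + c₁ * w r + c₂ * w r ^ 2 with hP
  have jw : IsJet atTop w w 0 1 0 := IsJet.self
  have jc := fun a : ℝ => IsJet.const (l := atTop) (w := w) a
  have jP : IsJet atTop w P 1 c₁ c₂ := by simp [IsJet, hP, isBigO_zero]
  have jT := IsJet.comp hw hT jP
  have hPt := jP.tendsto hw
  have hTP : Tendsto (fun r => T (P r)) atTop (𝓝 0) := hT0 ▸ hT.continuousAt.tendsto.comp hPt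
  have hTy : Tendsto (fun r => T (y r)) atTop (𝓝 0) := hT0 ▸ hT.continuousAt.tendsto.comp hy
  have jH : IsJet atTop w (fun r => P r * ((w r + κ) * T (P r) - w r)
      + 2 * (w r * (1 + w r) * (c₁ + 2 * c₂ * w r) * T (P r))) 0 0 0 := by
    -- The coefficients of `w` and `w²` in the residual vanish exactly by `hc₁` and `hc₂`.
    refine ((jP.mul hw (((jw.add (jc κ)).mul hw jT).sub jw)).add
      (((((jw.mul hw ((jc 1).add jw)).mul hw
        ((jc c₁).add (jw.const_mul (2 * c₂)))).mul hw jT)).const_mul 2)).coeff_eq ?_ ?_ ?_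
    · simp [hT0]
    · simp only [hT0]
      linear_combination hc₁
    · simp only [hT0, ← ht₁]
      linear_combination hc₂ + c₁ * hc₁
  -- Strict differentiability is needed because both `y` and `P` move.
  have hD : (fun r => T (y r) - T (P r) - t₁ * (y r - P r)) =o[atTop] fun r => y r - P r := by
    have := (hT.hasStrictDerivAt (by simp)).hasStrictFDerivAt.isLittleO
    refine (this.comp_tendsto (hy.prodMk_nhds hPt)).congr (fun r => ?_) fun r => rfl
    simp [Function.comp, t₁, mul_comm]
  have hA : Tendsto (fun r => y r * (w r + κ) + 2 * (w r * (1 + w r) * (c₁ + 2 * c₂ * w r)))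
      atTop (𝓝 κ) := by
    have := (hy.mul (hw.add_const κ)).add (((hw.mul (hw.const_add 1)).mul
      ((hw.const_mul (2 * c₂)).const_add c₁)).const_mul 2)
    simpa using this
  have hB : Tendsto (fun r =>
      t₁ * (y r * (w r + κ) + 2 * (w r * (1 + w r) * (c₁ + 2 * c₂ * w r)))
        + T (P r) * (w r + κ) - w r - κ * t₁ + 6 * ((1 + w r) * T (y r))) atTop (𝓝 0) := by
    have := ((((hA.const_mul t₁).add (hTP.mul (hw.add_const κ))).sub hw).sub_const
      (κ * t₁)).add (((hw.const_add 1).mul hTy).const_mul 6)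
    simpa [mul_comm] using this
  have hAD := ((hA.isBigO_one ℝ).mul_isLittleO hD)
  have hBE := ((isLittleO_one_iff ℝ).2 hB).mul_isBigO
    (isBigO_refl (fun r => y r - P r) atTop)
  simp only [one_mul] at hAD hBE
  set m := -(κ * t₁) with hm
  have hm0 : 0 < m := by
    have := mul_neg_of_pos_of_neg hκ hT1
    linarith
  have hAB := (hAD.add hBE).def (half_pos hm0)
  obtain ⟨C, hC, hCb⟩ := jH.isBigO_cube.exists_pos
  have hev := (((((hw0.and hyd).and hwd).and hAB).and hCb.bound).and
    ((hw.eventually_lt_const one_pos).and (eventually_gt_atTop (0 : ℝ))))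
  obtain ⟨R₀, hR₀⟩ := eventually_atTop.1 hev
  set R := max R₀ 1 with hRdef
  have hR : 0 < R := lt_max_of_lt_right one_pos
  -- `H` is `r w (y - P)'`. In `hderiv` the extra term with factor 6 comes from differentiating
  -- `w⁻³` along `r w' = -2 (1 + w) T(y)`.
  set H : ℝ → ℝ := fun r => y r * ((w r + κ) * T (y r) - w r)
      + 2 * (w r * (1 + w r) * (c₁ + 2 * c₂ * w r) * T (y r)) with hH
  have hderiv : ∀ r, R ≤ r → HasDerivAt (fun r => ((y r - P r) / w r ^ 3) ^ 2)
      (2 * (y r - P r) * (H r + 6 * (y r - P r) * ((1 + w r) * T (y r))) / (w r ^ 7 * r)) r := by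
    intro r hr
    obtain ⟨⟨⟨⟨⟨hw0, hyd⟩, hwd⟩, -⟩, -⟩, -, hr0⟩ := hR₀ r (le_of_max_le_left hr)
    have hPd : HasDerivAt P _ r :=
      ((hwd.const_mul c₁).const_add 1).add ((hwd.pow 2).const_mul c₂)
    have := (((hyd.sub hPd).div (hwd.pow 3) (pow_ne_zero 3 hw0.ne')).pow 2)
    refine this.congr_deriv ?_
    simp only [hH, Pi.sub_apply, Pi.div_apply, Pi.pow_apply, Nat.reduceSub, pow_one]
    generalize P r = p
    field_simp
    push_cast
    ring
  -- Above this level `C w³ ≤ (m/4) |E|`; with the `m/2` from `hAB` the perturbation is at most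
  -- `(3/4) m |E|`, leaving contraction `m/4`.
  set K := (4 * C / m) ^ 2 with hK
  have hK0 : 0 < K := by positivity
  have hbound := eventually_le_of_drift (K := K) (c := m / 2 * K) hR (by positivity) hderiv
    fun r hr hKr => ?_
  · refine IsBigO.of_bound (4 * C / m) ?_
    filter_upwards [hbound, hw0] with r h1 hwr
    have h2 := abs_le_of_sq_le_sq h1 (by positivity)
    rw [abs_div, abs_of_pos (pow_pos hwr 3), div_le_iff₀ (by positivity)] at h2
    rwa [Real.norm_eq_abs, Real.norm_eq_abs, abs_of_pos (pow_pos hwr 3)]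
  · obtain ⟨⟨⟨⟨⟨hw0, -⟩, -⟩, hab⟩, hcb⟩, hw1, hr0⟩ := hR₀ r (le_of_max_le_left hr)
    have hw3 : 0 < w r ^ 3 := pow_pos hw0 3
    simp only [Real.norm_eq_abs, abs_of_pos hw3] at hab hcb
    set E := y r - P r with hE
    have h2 : 4 * C / m * w r ^ 3 ≤ |E| := by
      have := sq_le_sq.1 hKr
      rwa [abs_div E, abs_of_pos hw3, abs_of_pos (by positivity), le_div_iff₀ hw3] at this
    have h3 : C * w r ^ 3 ≤ m / 4 * |E| := by
      calc C * w r ^ 3 = m / 4 * (4 * C / m * w r ^ 3) := by field_simp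
        _ ≤ _ := by gcongr
    have h4 : |H r + 6 * E * ((1 + w r) * T (y r)) + m * E| ≤ 3 / 4 * m * |E| := by
      refine le_trans (le_of_eq ?_) ((abs_add_le _ _).trans
        ((add_le_add (hcb.trans h3) hab).trans_eq (by ring)))
      congr 1
      simp only [hH, hE, hm]
      ring
    have h5 : E * (H r + 6 * E * ((1 + w r) * T (y r))) ≤ -(m / 4 * E ^ 2) := by
      have h6 := (le_abs_self _).trans_eq
        (abs_mul E (H r + 6 * E * ((1 + w r) * T (y r)) + m * E))
      have h7 := mul_le_mul_of_nonneg_left h4 (abs_nonneg E)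
      have h8 : |E| * (3 / 4 * m * |E|) = 3 / 4 * m * E ^ 2 := by
        rw [← sq_abs E]
        ring
      linarith
    have h6 : K * w r ^ 6 ≤ E ^ 2 := by
      rwa [div_pow, le_div_iff₀ (by positivity), ← pow_mul] at hKr
    rw [div_le_div_iff₀ (by positivity) hr0]
    have h7 : w r ^ 7 ≤ w r ^ 6 := pow_le_pow_of_le_one hw0.le hw1.le (by norm_num)
    have h8 : K * w r ^ 7 ≤ E ^ 2 := (mul_le_mul_of_nonneg_left h7 hK0.le).trans h6
    have h9 : 2 * E * (H r + 6 * E * ((1 + w r) * T (y r))) ≤ -(m / 2 * K) * w r ^ 7 := by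
      have := mul_le_mul_of_nonneg_left h8 (half_pos hm0).le
      linarith
    calc _ ≤ -(m / 2 * K) * w r ^ 7 * r := mul_le_mul_of_nonneg_right h9 hr0.le
      _ = _ := by ring

/-! ### From powers of `v^(-2)` to powers of `r^(-2α)` -/

theorem IsJet.rpow {ι : Type*} {l : Filter ι} {w f : ι → ℝ} {b c : ℝ} (p : ℝ)
    (hw : Tendsto w l (𝓝 0)) (hf : IsJet l w f 1 b c) :
    IsJet l w (fun x => f x ^ p) 1 (p * b) (p * c + p * (p - 1) / 2 * b ^ 2) := by
  have h1 : ∀ q x : ℝ, x ≠ 0 → deriv (fun x : ℝ => x ^ q) x = q * x ^ (q - 1) := fun q x hx =>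
    (Real.hasDerivAt_rpow_const (Or.inl hx)).deriv
  have h2 : iteratedDeriv 2 (fun x : ℝ => x ^ p) 1 = p * (p - 1) := by
    simp only [iteratedDeriv_succ, iteratedDeriv_zero]
    have : deriv (fun x : ℝ => x ^ p) =ᶠ[𝓝 1] fun x => p * x ^ (p - 1) :=
      (eventually_ne_nhds one_ne_zero).mono fun x hx => h1 p x hx
    rw [this.deriv_eq, ((Real.hasDerivAt_rpow_const (Or.inl one_ne_zero)).const_mul p).deriv]
    simp
  refine (IsJet.comp hw (φ := fun x => x ^ p)
    (Real.contDiffAt_rpow_const_of_ne one_ne_zero) hf).coeff_eq ?_ ?_ ?_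
  · simp
  · simp [h1 p 1 one_ne_zero]
  · simp [h1 p 1 one_ne_zero, h2]

/-- The expansion of `v` in powers of `r^(-2α)`, from that of the slope argument in powers of
`v^(-2)`. -/
theorem slope_expansion {α c₁ c₂ : ℝ} {v : ℝ → ℝ} (hα : 0 < α) (hv : Tendsto v atTop atTop)
    (hy : IsJet atTop (fun r => 1 / v r ^ 2) (fun r => slopeArg α r (v r)) 1 c₁ c₂) {a b : ℝ}
    (ha : a = -(α * beta α + α * c₁))
    (hb : b = α * beta α * (α * beta α - 1) / 2 + α * beta α * (α * c₁) +
      (α * c₂ + α * (α - 1) / 2 * c₁ ^ 2) - 2 * a ^ 2) :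
    (fun r : ℝ => v r - (r ^ α - a / r ^ α + b / r ^ (3 * α)))
      =o[atTop] fun r : ℝ => r ^ (-(4 * α)) := by
  set w : ℝ → ℝ := fun r => 1 / v r ^ 2 with hwdef
  have hw : Tendsto w atTop (𝓝 0) :=
    tendsto_const_nhds.div_atTop ((tendsto_pow_atTop two_ne_zero).comp hv)
  have jw : IsJet atTop w w 0 1 0 := IsJet.self
  have jc := fun a : ℝ => IsJet.const (l := atTop) (w := w) a
  have hpos : ∀ᶠ r in atTop, 0 < r ∧ 0 < v r :=
    (eventually_gt_atTop 0).and (hv.eventually_gt_atTop 0)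
  have jq0 := ((((jc 1).add jw).coeff_eq (a' := 1) (by ring) (b' := 1) (by ring) (c' := 0)
    (by ring)).rpow (α * beta α) hw).mul hw (hy.rpow α hw)
  -- The powers of `v` combine because `2αβ = α - 1`.
  have hq : (fun r => (1 + w r) ^ (α * beta α) * slopeArg α r (v r) ^ α)
      =ᶠ[atTop] fun r => v r / r ^ α := by
    filter_upwards [hpos] with r ⟨hr, hvr⟩
    have hp : 0 < 1 + v r ^ 2 := by positivity
    have h1 : 1 + w r = (1 + v r ^ 2) / v r ^ 2 := by
      simp only [hwdef]
      field_simp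
      ring
    have h2 : v r ^ α = v r * (v r ^ 2) ^ (α * beta α) := by
      rw [← Real.rpow_natCast, ← Real.rpow_mul hvr.le, ← Real.rpow_one_add' hvr.le]
      · congr 1
        have := one_sub_two_mul_beta hα
        field_simp at this
        push_cast
        linarith
      · have := one_sub_two_mul_beta hα
        field_simp at this
        push_cast
        linarith
    rw [h1, slopeArg, Real.div_rpow hp.le (by positivity),
      Real.div_rpow hvr.le (by positivity), Real.mul_rpow hr.le (by positivity),
      ← Real.rpow_mul hp.le, h2, mul_comm (beta α) α]
    have := Real.rpow_pos_of_pos hp (α * beta α)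
    field_simp
  have jq := (jq0.congr' hq)
  have hqt := jq.tendsto hw
  have hρ : (fun r => w r * (v r / r ^ α * (v r / r ^ α))) =ᶠ[atTop] fun r => r ^ (-(2 * α)) := by
    filter_upwards [hpos] with r ⟨hr, hvr⟩
    have h1 : r ^ (2 * α) = (r ^ α) ^ 2 := by
      rw [← Real.rpow_natCast, ← Real.rpow_mul hr.le]
      congr 1
      push_cast
      ring
    simp only [hwdef]
    rw [Real.rpow_neg hr.le, h1]
    field_simp
  have jρ := (jw.mul hw (jq.mul hw jq)).congr' hρ
  -- With `q = v / r^α` and `ρ = r^(-2α)`, this is `q - 1 + a ρ - b ρ²`, the error divided by `r^α`;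
  -- `ha` and `hb` cancel its jet.
  have jZ := ((jq.sub (jc 1)).add (jρ.const_mul a)).sub ((jρ.mul hw jρ).const_mul b)
  have hZ := (jZ.coeff_eq (a' := 0) (b' := 0) (c' := 0) (by ring) (by rw [ha]; ring)
    (by rw [hb, ha]; ring)).isBigO_cube
  have hwρ : w =O[atTop] fun r => r ^ (-(2 * α)) := by
    have h1 : Tendsto (fun r => (v r / r ^ α * (v r / r ^ α))⁻¹) atTop (𝓝 1) := by
      simpa using (hqt.mul hqt).inv₀ (by norm_num)
    refine ((h1.isBigO_one ℝ).mul hρ.isBigO).congr' ?_ (by simp)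
    filter_upwards [hpos] with r ⟨hr, hvr⟩
    field_simp
  -- The error is `r^α · O(r^(-6α)) = O(r^(-5α))`.
  have h6 := (isBigO_refl (fun r : ℝ => r ^ α) atTop).mul (hZ.trans (hwρ.pow 3))
  have hlo : (fun r : ℝ => r ^ (-(5 * α))) =o[atTop] fun r : ℝ => r ^ (-(4 * α)) := by
    refine isLittleO_of_tendsto' (hpos.mono fun r hr h => ?_)
      ((tendsto_rpow_neg_atTop hα).congr' ?_)
    · exact absurd h (Real.rpow_pos_of_pos hr.1 _).ne'
    · filter_upwards [hpos] with r hr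
      rw [← Real.rpow_sub hr.1]
      congr 1
      ring
  have h7 : (fun r : ℝ => r ^ α * (r ^ (-(2 * α))) ^ 3)
      =o[atTop] fun r : ℝ => r ^ (-(4 * α)) := by
    refine hlo.congr' ?_
      EventuallyEq.rfl
    filter_upwards [hpos] with r ⟨hr, _⟩
    rw [← Real.rpow_natCast, ← Real.rpow_mul hr.le, ← Real.rpow_add hr]
    congr 1
    push_cast
    ring
  refine (h6.trans_isLittleO h7).congr' ?_ EventuallyEq.rfl
  filter_upwards [hpos] with r ⟨hr, _⟩
  have h1 : r ^ (2 * α) = (r ^ α) ^ 2 := by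
    rw [← Real.rpow_natCast, ← Real.rpow_mul hr.le]
    congr 1
    push_cast
    ring
  have h3 : r ^ (3 * α) = (r ^ α) ^ 3 := by
    rw [← Real.rpow_natCast, ← Real.rpow_mul hr.le]
    congr 1
    push_cast
    ring
  rw [Real.rpow_neg hr.le, h1, h3]
  have := Real.rpow_pos_of_pos hr α
  field_simp
  ring

/-! ### Application to solutions with admissible start -/

theorem slopeArg_asymptotics {α R : ℝ} {v g T : ℝ → ℝ} (hα : 0 < α) (hR : 0 < R)
    (hv : ∀ r, R ≤ r →
      HasDerivAt v ((1 + v r ^ 2) ^ (beta α + 1) * g (slopeArg α r (v r))) r)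
    (hvt : Tendsto v atTop atTop)
    (hyt : Tendsto (fun r => slopeArg α r (v r)) atTop (𝓝[≤] 1))
    (hT : ContDiffAt ℝ 3 T 1) (hT0 : T 1 = 0) (hT1 : deriv T 1 < 0)
    (hg : g =ᶠ[𝓝[≤] 1] fun y => y * T y) {c₁ c₂ : ℝ}
    (hc₁ : deriv T 1 * c₁ = α)
    (hc₂ : deriv T 1 * c₂ + iteratedDeriv 2 T 1 / 2 * c₁ ^ 2 = -(α ^ 2 * (1 + 2 * c₁))) :
    IsJet atTop (fun r => 1 / v r ^ 2) (fun r => slopeArg α r (v r)) 1 c₁ c₂ := by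
  have hgy : ∀ᶠ r in atTop, g (slopeArg α r (v r)) = slopeArg α r (v r) * T (slopeArg α r (v r)) :=
    hyt.eventually hg
  refine isJet_of_slow_fast (κ := 1 / α) (by positivity) hT hT0 hT1
    (hyt.mono_right nhdsWithin_le_nhds)
    (tendsto_const_nhds.div_atTop ((tendsto_pow_atTop two_ne_zero).comp hvt)) ?_ ?_ ?_ ?_ ?_
  · filter_upwards [hvt.eventually_gt_atTop 0] with r hr
    positivity
  · filter_upwards [hgy, eventually_ge_atTop R, hvt.eventually_gt_atTop 0] with r h1 h2 h3
    refine (hasDerivAt_slopeArg (hR.trans_le h2) (hv r h2)).congr_deriv ?_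
    rw [h1, one_sub_two_mul_beta hα]
    simp
  · filter_upwards [hgy, eventually_ge_atTop R, hvt.eventually_gt_atTop 0] with r h1 h2 h3
    have hr := hR.trans_le h2
    have hd : HasDerivAt (fun r => 1 / v r ^ 2) _ r :=
      (hasDerivAt_const r (1 : ℝ)).div ((hv r h2).pow 2) (pow_ne_zero 2 h3.ne')
    refine hd.congr_deriv ?_
    rw [h1]
    have hp : 0 < 1 + v r ^ 2 := by positivity
    have hb := Real.rpow_pos_of_pos hp (beta α)
    generalize T (slopeArg α r (v r)) = t
    simp only [slopeArg, Real.rpow_add hp, Real.rpow_one, Nat.reduceSub, pow_one]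
    field_simp
    push_cast
    ring
  · rw [hc₁]
    field_simp
  · rw [hc₂, hc₁]
    field_simp

/-- Both kinds of start give a right limit of the slope argument at `r₀`. The strict inequality on
`y₂` allows moving to some `R > r₀`, beyond which derivatives are two-sided. -/
theorem exists_start {n : ℕ} {Γ : Set (Fin n → ℝ)} {γ : (Fin n → ℝ) → ℝ} {α r₀ y₂ : ℝ}
    {v : ℝ → ℝ} (hv : IsSlopeSolution Γ γ α r₀ v) (hs : HasAdmissibleStart γ α r₀ v)
    (hy₂ : y₂ < 1 / restrict γ 1 1 ^ (1 / α)) :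
    ∃ R, 0 < R ∧ r₀ < R ∧ y₂ ≤ slopeArg α R (v R) := by
  obtain ⟨y₀, hr₀, hy₀, ht⟩ : ∃ y₀, 0 ≤ r₀ ∧ y₀ ∈ admissibleInterval γ α ∧
      Tendsto (fun r => slopeArg α r (v r)) (𝓝[>] r₀) (𝓝 y₀) := by
    rcases hs with ⟨hr₀, hs⟩ | ⟨rfl, y₀, hy₀, ht⟩
    · refine ⟨_, hr₀.le, hs, ?_⟩
      have hvc : Tendsto v (𝓝[>] r₀) (𝓝 (v r₀)) :=
        (hv.1 r₀ Set.self_mem_Ici).mono_left (nhdsWithin_mono _ Set.Ioi_subset_Ici_self)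
      have hid : Tendsto (fun r : ℝ => r) (𝓝[>] r₀) (𝓝 r₀) := nhdsWithin_le_nhds
      exact hvc.div (hid.mul (((hvc.pow 2).const_add 1).rpow_const (Or.inl (by positivity))))
        (by positivity)
    · exact ⟨y₀, le_rfl, hy₀, ht⟩
  obtain ⟨R, h1, h2⟩ := ((ht.eventually_const_lt (hy₂.trans_le hy₀.1)).and
    self_mem_nhdsWithin).exists
  exact ⟨R, hr₀.trans_lt h2, h2, h1.le⟩

end Translator

/-- Fine asymptotics at infinity of the slope of bowl-type translators for a `1`-nondegenerate,
normalized, positive `α`-homogeneous curvature function with `α > 1/3`. The first two conjuncts say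
that the derivatives of `g₊(·, 1)` at the endpoint `1` that enter the coefficients exist and that
the denominators do not vanish. -/
theorem theorem4p1 (n : ℕ) (hn : 2 ≤ n) (α : ℝ) (hα : 1 / 3 < α)
    (Γ : Set (Fin n → ℝ)) (γ : (Fin n → ℝ) → ℝ)
    (hγ : IsCurvatureFunction Γ γ α)
    (hnondeg : IsNondegenerate Γ 1)
    (hnorm : restrict γ 0 1 = 1) :
    ContDiffWithinAt ℝ 2 (fun y => gPlus Γ γ y 1) (Set.Iic 1) 1 ∧
    gPlusDeriv Γ γ < 0 ∧
    ∀ (r₀ : ℝ) (v : ℝ → ℝ), IsSlopeSolution Γ γ α r₀ v → HasAdmissibleStart γ α r₀ v →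
      (fun r : ℝ => v r -
          (r ^ α - coeffA α (gPlusDeriv Γ γ) / r ^ α
            + coeffB α (gPlusDeriv Γ γ) (gPlusDeriv2 Γ γ) / r ^ (3 * α)))
        =o[atTop] (fun r : ℝ => r ^ (-(4 * α))) := by
  have hα0 : 0 < α := hγ.alpha_pos
  obtain ⟨T, hT, hT0, hT1, hgT⟩ := exists_smooth_gPlus hn hγ hnondeg hnorm
  rw [gPlusDeriv_eq hT hT0 hgT, gPlusDeriv2_eq hT hgT]
  refine ⟨contDiffWithinAt_gPlus hT hgT, hT1, fun r₀ v hv hs => ?_⟩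
  -- The barrier is the point with ratio `x / y = 2`: there `g₊ = 2 y`, and since `2 > 1` it lies
  -- strictly below the admissible interval.
  have hy₂ := profile_pos hγ hnondeg (zero_le_two (α := ℝ))
  obtain ⟨R, hR, hr₀R, hstart⟩ := exists_start hv hs (lt_one_div_rpow_restrict hn hγ hnondeg)
  set g : ℝ → ℝ := fun y => gPlus Γ γ y 1 with hgdef
  have hvd : ∀ r, R ≤ r →
      HasDerivAt v ((1 + v r ^ 2) ^ (beta α + 1) * g (slopeArg α r (v r))) r := fun r hr =>
    (hv.2 r (hr₀R.le.trans hr) (hR.trans_le hr)).hasDerivAt (Ici_mem_nhds (hr₀R.trans_le hr))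
  have hy := le_slopeArg hα0 hR hvd hy₂
    (by simp only [hgdef]; rw [gPlus_profile hn hγ hnondeg zero_le_two, mul_comm]) hstart
  have hvt := tendsto_slope_atTop hR hvd (fun y => gPlus_nonneg y 1) hy₂ hy
  have hyt := tendsto_slopeArg hα0 hR hvd
    (fun y => gPlus_eq_zero_of_one_le hn hγ hnondeg hnorm) hy₂
    (fun z => exists_pos_mul_le_gPlus hn hγ hnondeg hnorm zero_le_two) hy hvt
  have hT1' : deriv T 1 ≠ 0 := hT1.ne
  have hT3 : ContDiffAt ℝ 3 T 1 := hT.of_le (WithTop.coe_le_coe.2 (le_top : (3 : ℕ∞) ≤ ⊤))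
  -- `c₁` and `c₂` solve the two matching conditions, linear in each unknown since `T'(1) ≠ 0`.
  have hjet := slopeArg_asymptotics hα0 hR hvd hvt hyt hT3 hT0 hT1 hgT
    (c₁ := α / deriv T 1)
    (c₂ := (-(α ^ 2 * (1 + 2 * (α / deriv T 1)))
      - iteratedDeriv 2 T 1 / 2 * (α / deriv T 1) ^ 2) / deriv T 1)
    (by field_simp) (by field_simp; ring)
  refine slope_expansion hα0 hvt hjet ?_ ?_
  · unfold coeffA
    ring
  · unfold coeffB coeffA
    rw [one_sub_two_mul_beta hα0]
    unfold beta
    field_simp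
    ring
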